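/- Let $S$ be a topological space. A function $f:S\to\mathbb{R}$ is *upper pseudo-continuous* if for all $x,y\in S$ with $f(x)<f(y)$ there is a neighbourhood $V$ of $x$ such that $f(x')<f(y)$ for all $x'\in V$; it is *lower pseudo-continuous* if $-f$ is upper pseudo-continuous, and *pseudo-continuous* if it is both. A real-valued function $g$ on a convex set $X$ is *quasi-concave* if $\{y\in X: g(y)\ge\lambda\}$ is convex for every $\lambda\in\mathbb{R}$. Consider the following two assertions. **(A) (Ky Fan's minimax inequality)** For every non-empty compact convex subset $X$ of a Hausdorff real topological vector space and every $f:X\times X\to\mathbb{R}$ such that (i) for each $y\in X$, $f(\cdot,y)$ is lower semicontinuous, and (ii) for each $x\in X$, $f(x,\cdot)$ is quasi-concave, one has $$\min_{x\in X}\sup_{y\in X}f(x,y)\le\sup_{x\in X}f(x,x),$$ where the suprema are taken in $[-\infty,+\infty]$ and the minimum is attained. **(B) (pseudo-continuous version)** For every non-empty compact convex subset $X$ of a Hausdorff real topological vector space and every $f:X\times X\to\mathbb{R}$ such that (i) $f$ is pseudo-continuous on $X\times X$, and (ii) for each $x\in X$, $f(x,\cdot)$ is quasi-concave, one has $$\min_{x\in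 X}\max_{y\in X}f(x,y)\le\max_{x\in X}f(x,x),$$ where the maxima and the minimum are attained. **Proposition.** Assertions (A) and (B) are equivalent: (A) holds if and only if (B) holds. -/

import Mathlib

open Set Filter Topology

universe u

/-- `f` is upper pseudo-continuous: whenever `f x < f y`, one has `f x' < f y` for all `x'` in
some neighbourhood of `x`. -/
def UpperPseudoContinuous {S : Type*} [TopologicalSpace S] (f : S → ℝ) : Prop :=
  ∀ x y : S, f x < f y → ∃ V ∈ 𝓝 x, ∀ x' ∈ V, f x' < f y

/-- `f` is lower pseudo-continuous if `-f` is upper pseudo-continuous. -/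
def LowerPseudoContinuous {S : Type*} [TopologicalSpace S] (f : S → ℝ) : Prop :=
  UpperPseudoContinuous (fun x => -f x)

/-- `f` is pseudo-continuous if it is both upper and lower pseudo-continuous. -/
def PseudoContinuous {S : Type*} [TopologicalSpace S] (f : S → ℝ) : Prop :=
  UpperPseudoContinuous f ∧ LowerPseudoContinuous f

/-- A real-valued function defined on a subset `X` of a real vector space is quasi-concave if all
its upper level sets `{y ∈ X | f y ≥ r}`, viewed as subsets of the vector space, are convex. -/
def QuasiConcave {E : Type*} [AddCommGroup E] [Module ℝ E] {X : Set E} (f : X → ℝ) : Prop :=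
  ∀ r : ℝ, Convex ℝ (Subtype.val '' {y : X | r ≤ f y})

/-- Ky Fan's minimax inequality, for all non-empty compact convex subsets `X` of all Hausdorff real
topological vector spaces and all `f : X × X → ℝ` that are lower semicontinuous in the first and
quasi-concave in the second variable: `min_x sup_y f (x, y) ≤ sup_x f (x, x)`. The suprema are
taken in the extended reals (they may be `+∞`), and that the minimum over `x` is attained is part
of the assertion. -/
def KyFanMinimax : Prop :=
  ∀ (E : Type u) [AddCommGroup E] [Module ℝ E] [TopologicalSpace E] [IsTopologicalAddGroup E]
    [ContinuousSMul ℝ E] [T2Space E] (X : Set E),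
    X.Nonempty → IsCompact X → Convex ℝ X →
    ∀ f : X × X → ℝ,
      (∀ y : X, LowerSemicontinuous (fun x : X => f (x, y))) →
      (∀ x : X, QuasiConcave (fun y : X => f (x, y))) →
      ∃ m : EReal, IsLeast (range (fun x : X => ⨆ y : X, (f (x, y) : EReal))) m ∧
        m ≤ ⨆ x : X, (f (x, x) : EReal)

/-- The minimax inequality for pseudo-continuous functions, for all non-empty compact convex subsets
`X` of all Hausdorff real topological vector spaces and all pseudo-continuous `f : X × X → ℝ` that
are quasi-concave in the second variable: `min_x max_y f (x, y) ≤ max_x f (x, x)`. That the two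
maxima and the minimum are attained is part of the assertion; `M x` is `max_y f (x, y)`. -/
def PseudoContinuousMinimax : Prop :=
  ∀ (E : Type u) [AddCommGroup E] [Module ℝ E] [TopologicalSpace E] [IsTopologicalAddGroup E]
    [ContinuousSMul ℝ E] [T2Space E] (X : Set E),
    X.Nonempty → IsCompact X → Convex ℝ X →
    ∀ f : X × X → ℝ,
      PseudoContinuous f →
      (∀ x : X, QuasiConcave (fun y : X => f (x, y))) →
      ∃ (M : X → ℝ) (m d : ℝ),
        (∀ x : X, IsGreatest (range (fun y : X => f (x, y))) (M x)) ∧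
        IsLeast (range M) m ∧
        IsGreatest (range (fun x : X => f (x, x))) d ∧
        m ≤ d

/-! (A) ⇒ (B): pseudo-continuity makes strict level sets at attained values open, which is enough
for Weierstrass. A pseudo-continuous `f` need not be lower semicontinuous, but only the level `d =
max f(x, x)` matters. Ky Fan applied to the indicator of the open set `{f > d}`, which vanishes on
the diagonal, gives an `x` with `f(x, ·) ≤ d`. (B) ⇒ (A): continuous functions are
pseudo-continuous, so (B) yields Brouwer's theorem, and Brouwer on a finite simplex yields Ky Fan
through a partition of unity. -/

theorem UpperPseudoContinuous.isOpen_lt {S : Type*} [TopologicalSpace S] {f : S → ℝ}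
    (hf : UpperPseudoContinuous f) (z : S) : IsOpen {x | f x < f z} := by
  rw [isOpen_iff_mem_nhds]
  intro x hx
  obtain ⟨V, hV, h⟩ := hf x z hx
  exact mem_of_superset hV h

theorem LowerPseudoContinuous.isOpen_gt {S : Type*} [TopologicalSpace S] {f : S → ℝ}
    (hf : LowerPseudoContinuous f) (z : S) : IsOpen {x | f z < f x} := by
  have h := UpperPseudoContinuous.isOpen_lt (f := fun x => -f x) hf z
  simpa only [neg_lt_neg_iff] using h

theorem Continuous.upperPseudoContinuous {S : Type*} [TopologicalSpace S] {f : S → ℝ}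
    (hf : Continuous f) : UpperPseudoContinuous f := fun _ y hxy =>
  ⟨{z | f z < f y}, (isOpen_lt hf continuous_const).mem_nhds hxy, fun _ h => h⟩

theorem Continuous.pseudoContinuous {S : Type*} [TopologicalSpace S] {f : S → ℝ}
    (hf : Continuous f) : PseudoContinuous f :=
  ⟨hf.upperPseudoContinuous, hf.neg.upperPseudoContinuous⟩

/-- A Weierstrass theorem: a real function on a non-empty compact space attains its maximum as soon
as its strict lower level sets at attained values are open. -/
theorem exists_forall_le_of_isOpen_lt {S : Type*} [TopologicalSpace S] [CompactSpace S] [Nonempty S]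
    {f : S → ℝ} (hf : ∀ z, IsOpen {x | f x < f z}) : ∃ z, ∀ x, f x ≤ f z := by
  by_contra! h
  obtain ⟨t, ht⟩ := isCompact_univ.elim_finite_subcover (fun z => {x | f x < f z}) hf
    (fun x _ => mem_iUnion.2 (h x))
  have hne : t.Nonempty := by
    obtain ⟨x⟩ := ‹Nonempty S›
    obtain ⟨z, hz, -⟩ := mem_iUnion₂.1 (ht (mem_univ x))
    exact ⟨z, hz⟩
  obtain ⟨z, -, hz⟩ := t.exists_max_image f hne
  obtain ⟨w, hw, hlt⟩ := mem_iUnion₂.1 (ht (mem_univ z))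
  exact (hz w hw).not_gt hlt

/-- Strict upper level sets of a quasi-concave function are convex. -/
theorem QuasiConcave.convex_gt {E : Type*} [AddCommGroup E] [Module ℝ E] {X : Set E} {f : X → ℝ}
    (hf : QuasiConcave f) (s : EReal) :
    Convex ℝ (Subtype.val '' {y : X | s < (f y : EReal)}) := by
  rintro _ ⟨x, hx, rfl⟩ _ ⟨y, hy, rfl⟩ a b ha hb hab
  -- Quasi-concavity is used at a real level, since `s` may be infinite.
  obtain ⟨z, hz, hzeq⟩ := hf (min (f x) (f y)) ⟨x, min_le_left (f x) (f y), rfl⟩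
    ⟨y, min_le_right (f x) (f y), rfl⟩ ha hb hab
  refine ⟨z, ?_, hzeq⟩
  have hz' : ((min (f x) (f y) : ℝ) : EReal) ≤ f z := EReal.coe_le_coe_iff.2 hz
  refine lt_of_lt_of_le ?_ hz'
  rcases min_choice (f x) (f y) with h | h <;> rw [h]
  exacts [hx, hy]

theorem PseudoContinuousMinimax.of_kyFan (H : KyFanMinimax.{u}) : PseudoContinuousMinimax.{u} := by
  intro E _ _ _ _ _ _ X hne hc hconv f hf hq
  have : CompactSpace X := isCompact_iff_compactSpace.1 hc
  have : Nonempty X := hne.to_subtype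
  have hmax (x : X) : ∃ y, ∀ y', f (x, y') ≤ f (x, y) :=
    exists_forall_le_of_isOpen_lt fun z =>
      (hf.1.isOpen_lt (x, z)).preimage (by fun_prop : Continuous fun y : X => (x, y))
  choose y hy using hmax
  obtain ⟨x₀, hx₀⟩ : ∃ z, ∀ x, f (x, x) ≤ f (z, z) :=
    exists_forall_le_of_isOpen_lt (f := fun x : X => f (x, x)) fun z =>
      (hf.1.isOpen_lt (z, z)).preimage (by fun_prop : Continuous fun x : X => (x, x))
  obtain ⟨x₁, hx₁⟩ : ∃ z, ∀ x, -f (x, y x) ≤ -f (z, y z) := by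
    refine exists_forall_le_of_isOpen_lt (f := fun x : X => -f (x, y x)) fun z => ?_
    -- The maximum over the second variable exceeds a level iff some section does, so openness
    -- passes to it as a union.
    have : {x | -f (x, y x) < -f (z, y z)} = ⋃ w, {x | f (z, y z) < f (x, w)} := by
      ext x
      simp only [neg_lt_neg_iff, mem_ofPred_eq, mem_iUnion]
      exact ⟨fun h => ⟨_, h⟩, fun ⟨w, h⟩ => h.trans_le (hy x w)⟩
    rw [this]
    exact isOpen_iUnion fun w => (hf.2.isOpen_gt (z, y z)).preimage
      (by fun_prop : Continuous fun x : X => (x, w))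
  refine ⟨fun x => f (x, y x), f (x₁, y x₁), f (x₀, x₀), ?_, ?_, ?_, ?_⟩
  · exact fun x => ⟨⟨y x, rfl⟩, forall_mem_range.2 (hy x)⟩
  · exact ⟨⟨x₁, rfl⟩, forall_mem_range.2 fun x => neg_le_neg_iff.1 (hx₁ x)⟩
  · exact ⟨⟨x₀, rfl⟩, forall_mem_range.2 hx₀⟩
  let U : Set (X × X) := {p | f (x₀, x₀) < f p}
  have hU : IsOpen U := hf.2.isOpen_gt _
  obtain ⟨m, ⟨⟨x, hx⟩, -⟩, hm⟩ := H E X hne hc hconv (U.indicator fun _ => 1)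
    (fun w => (hU.lowerSemicontinuous_indicator zero_le_one).comp (by fun_prop))
    (fun x r => by
      have hconvU : Convex ℝ (Subtype.val '' {w : X | (x, w) ∈ U}) := by
        simpa [U] using (hq x).convex_gt (f (x₀, x₀) : EReal)
      -- The upper level set is all of `X`, the section of `U`, or empty, according to `r ≤ 0`, `0 <
      -- r ≤ 1`, `1 < r`.
      rcases le_or_gt r 0 with hr | hr
      · have : {w : X | r ≤ U.indicator (fun _ => (1 : ℝ)) (x, w)} = univ :=
          eq_univ_of_forall fun w => hr.trans (indicator_nonneg (fun _ _ => zero_le_one) _)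
        simpa [this] using hconv
      rcases le_or_gt r 1 with hr1 | hr1
      · convert hconvU using 4 with w
        by_cases h : (x, w) ∈ U <;> simp [h, hr1, hr]
      · convert convex_empty (𝕜 := ℝ) (E := E)
        rw [image_eq_empty, eq_empty_iff_forall_notMem]
        intro w hw
        refine (hr1.trans_le hw).not_ge ?_
        by_cases h : (x, w) ∈ U <;> simp [h])
  have hdiag : m ≤ 0 := hm.trans <| iSup_le fun x => by
    have : (x, x) ∉ U := (hx₀ x).not_gt
    simp [this]
  refine (neg_le_neg_iff.1 (hx₁ x)).trans (le_of_not_gt fun h => ?_)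
  have hmem : (x, y x) ∈ U := h
  have h1 : ((U.indicator (fun _ => (1 : ℝ)) (x, y x) : ℝ) : EReal) ≤ 0 :=
    (le_iSup (fun w : X => ((U.indicator (fun _ => (1 : ℝ)) (x, w) : ℝ) : EReal)) (y x)).trans
      (hx.le.trans hdiag)
  rw [indicator_of_mem hmem, EReal.coe_one] at h1
  exact h1.not_gt zero_lt_one

/-- The pseudo-continuous minimax inequality implies Brouwer's fixed point theorem. -/
theorem PseudoContinuousMinimax.exists_fixedPoint (H : PseudoContinuousMinimax.{u})
    {E : Type u} [NormedAddCommGroup E] [NormedSpace ℝ E] {X : Set E} (hne : X.Nonempty)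
    (hc : IsCompact X) (hconv : Convex ℝ X) {p : X → X} (hp : Continuous p) :
    ∃ x, p x = x := by
  -- For fixed `x` the function is largest at `y = p x`, with value 0. Hence `0 ≤ m ≤ d`, so the
  -- diagonal maximizer `x₀` is at distance 0 from `p x₀`.
  obtain ⟨M, m, d, hM, ⟨⟨x₁, hx₁⟩, -⟩, ⟨⟨x₀, hx₀⟩, -⟩, hmd⟩ := H E X hne hc hconv
    (fun q => -‖(q.2 : E) - p q.1‖) (Continuous.pseudoContinuous (by fun_prop)) (fun x r => by
      have : Subtype.val '' {y : X | r ≤ -‖(y : E) - p x‖} =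
          X ∩ Metric.closedBall (p x : E) (-r) := by
        ext y
        simp only [mem_image, mem_ofPred_eq, Subtype.exists, exists_and_right, exists_eq_right,
          mem_inter_iff, Metric.mem_closedBall, dist_eq_norm, le_neg (a := r), exists_prop]
      rw [this]
      exact hconv.inter (convex_closedBall _ _))
  have h : (0 : ℝ) ≤ m := by
    rw [← hx₁]
    exact (hM x₁).2 ⟨p x₁, by simp⟩
  have h0 : (0 : ℝ) ≤ -‖(x₀ : E) - p x₀‖ := by
    have := h.trans hmd
    rwa [← hx₀] at this
  refine ⟨x₀, Subtype.ext ?_⟩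
  exact (sub_eq_zero.1 (norm_le_zero_iff.1 (by linarith))).symm

theorem KyFanMinimax.of_pseudoContinuous (H : PseudoContinuousMinimax.{u}) : KyFanMinimax.{u} := by
  intro E _ _ _ _ _ _ X hne hc hconv f hf hq
  have : CompactSpace X := isCompact_iff_compactSpace.1 hc
  have : Nonempty X := hne.to_subtype
  have hlsc (y : X) : LowerSemicontinuous fun x : X => (f (x, y) : EReal) :=
    continuous_coe_real_ereal.comp_lowerSemicontinuous (hf y) EReal.coe_strictMono.monotone
  have hsup : LowerSemicontinuous fun x : X => ⨆ y : X, (f (x, y) : EReal) :=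
    lowerSemicontinuous_iSup hlsc
  obtain ⟨x₀, -, hx₀⟩ := (hsup.lowerSemicontinuousOn univ).exists_isMinOn univ_nonempty
    isCompact_univ
  refine ⟨_, ⟨⟨x₀, rfl⟩, forall_mem_range.2 fun x => hx₀ (mem_univ x)⟩, ?_⟩
  set s : EReal := ⨆ x : X, (f (x, x) : EReal)
  by_contra! hlt
  obtain ⟨t, ht⟩ := isCompact_univ.elim_finite_subcover
    (fun y : X => {x : X | s < (f (x, y) : EReal)}) (fun y => (hlsc y).isOpen_preimage s)
    (fun x _ => mem_iUnion.2 (lt_iSup_iff.1 (hlt.trans_le (hx₀ (mem_univ x)))))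
  obtain ⟨ρ, hρ⟩ := PartitionOfUnity.exists_isSubordinate isClosed_univ
    (fun y : t => {x : X | s < (f (x, y) : EReal)}) (fun y => (hlsc y).isOpen_preimage s)
    (fun x hx => by
      obtain ⟨y, hy, h⟩ := mem_iUnion₂.1 (ht hx)
      exact mem_iUnion.2 ⟨⟨y, hy⟩, h⟩)
  have hρsum (x : X) : ∑ i, ρ i x = 1 := by
    rw [← finsum_eq_sum_of_fintype]
    exact ρ.sum_eq_one (mem_univ x)
  -- A continuous self-map of the simplex, through its barycentric image in `X`.
  let b : stdSimplex ℝ t → X := fun σ =>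
    ⟨∑ i, σ.1 i • ((i : X) : E), hconv.sum_mem (fun i _ => σ.2.1 i) σ.2.2 fun i _ => i.1.2⟩
  let p : stdSimplex ℝ t → stdSimplex ℝ t := fun σ =>
    ⟨fun i => ρ i (b σ), fun i => ρ.nonneg i _, hρsum _⟩
  have hb : Continuous b := by
    refine Continuous.subtype_mk (continuous_finsetSum _ fun i _ => ?_) _
    exact ((continuous_apply i).comp continuous_subtype_val).smul continuous_const
  have hp : Continuous p :=
    Continuous.subtype_mk (continuous_pi fun i => (ρ i).continuous.comp hb) _
  have hne' : (stdSimplex ℝ t).Nonempty :=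
    ⟨fun i => ρ i x₀, fun i => ρ.nonneg i _, hρsum _⟩
  -- The space `E` need not be normed, so Brouwer is applied to the weights in `t → ℝ` instead of to
  -- points of `X`.
  obtain ⟨σ, hσ⟩ := H.exists_fixedPoint hne' (isCompact_stdSimplex ℝ t) (convex_stdSimplex ℝ t) hp
  have hσρ (i : t) : σ.1 i = ρ i (b σ) := congrFun (congrArg Subtype.val hσ.symm) i
  -- At the fixed point, a vertex `i` of nonzero weight has `ρ i (b σ) ≠ 0`, so `s < f (b σ, i)` by
  -- subordination. Thus `b σ` is a convex combination of points of a convex strict level set and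
  -- lies in it, giving `s < f (b σ, b σ)`.
  have hmem : ((b σ : X) : E) ∈ Subtype.val '' {y : X | s < (f (b σ, y) : EReal)} := by
    have hfilter := Finset.sum_filter_ne_zero (s := Finset.univ) (f := σ.1)
    have hbary : ((b σ : X) : E) = ∑ i with σ.1 i ≠ 0, σ.1 i • ((i : X) : E) := by
      refine (Finset.sum_filter_of_ne (p := fun i => σ.1 i ≠ 0) fun i _ h h0 => h ?_).symm
      rw [h0, zero_smul]
    rw [hbary]
    refine ((hq (b σ)).convex_gt s).sum_mem (fun i _ => σ.2.1 i) (hfilter.trans σ.2.2)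
      fun i hi => ⟨i, ?_, rfl⟩
    refine hρ i (subset_tsupport _ ?_)
    rw [Function.mem_support, ← hσρ]
    exact (Finset.mem_filter.1 hi).2
  obtain ⟨z, hz, hzeq⟩ := hmem
  rw [Subtype.ext hzeq] at hz
  exact (le_iSup (fun x : X => (f (x, x) : EReal)) (b σ)).not_gt hz

theorem proposition4p3 : KyFanMinimax.{u} ↔ PseudoContinuousMinimax.{u} :=
  ⟨PseudoContinuousMinimax.of_kyFan, KyFanMinimax.of_pseudoContinuous⟩
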